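/- Let $d$ be a non-negative integer, let $\mathbf n=(n_1,\dots,n_d)$ be a tuple of positive integers, and write $[m]=\{1,\dots,m\}$. A rooted forest is an acyclic graph in which each connected component has exactly one distinguished vertex, called its root; each edge is oriented toward the root of its component, an edge oriented from $u$ to $v$ is written $(u,v)$, and then $u$ is called a child of $v$. Let $\mathcal F(\mathbf n)$ be the set of rooted forests with vertex set $\{(t,i) : t\in[d],\ i\in[n_t]\}$, where $(t,i)$ is said to have type $t$. For $F\in\mathcal F(\mathbf n)$, let $\mathrm{root}_s(F)$ be the number of roots of type $s$ of $F$, and let $\mathrm{ch}_s(t,i)$ be the number of children of type $s$ of the vertex $(t,i)$ in $F$. In the polynomial ring over $\mathbb Z$ in the indeterminates $z_s$ ($s\in[d]$) and $x_{s,t,i}$ ($s,t\in[d]$, $i\in[n_t]$), one has $$\sum_{F\in\mathcal F(\mathbf n)}\ \prod_{s\in[d]}z_s^{\mathrm{root}_s(F)}\prod_{s,t\in[d],\,i\in[n_t]}x_{s,t,i}^{\mathrm{ch}_s(t,i)}\;=\;\prod_{s\in[d]}\Bigl(z_s+\sum_{t\in[d],\,i\in[n_t]}x_{s,t,i}\Bigr)^{n_s-1}\cdot\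 \Gamma,$$ where $$\Gamma=\sum_{B\in F_d}\Bigl(\prod_{s\text{ root of }B}z_s\Bigr)\prod_{(s,t)\in B}\Bigl(\sum_{i\in[n_t]}x_{s,t,i}\Bigr),$$ $F_d$ is the set of rooted forests with vertex set $[d]$, and $(s,t)\in B$ means that $(s,t)$ is an oriented edge of $B$. -/

import Mathlib

/-- A rooted forest on the (finite) vertex set `V`: an acyclic graph together with a set of
distinguished vertices containing exactly one vertex of each connected component. -/
@[ext]
structure RootedForest (V : Type*) where
  graph : SimpleGraph V
  isAcyclic : graph.IsAcyclic
  roots : Finset V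
  existsUnique_root : ∀ c : graph.ConnectedComponent,
    ∃! r : V, r ∈ roots ∧ graph.connectedComponentMk r = c

namespace RootedForest

noncomputable instance instFintypeRootedForest {V : Type*} [Finite V] :
    Fintype (RootedForest V) :=
  haveI : Finite (RootedForest V) :=
    Finite.of_injective (β := SimpleGraph V × Finset V) (fun F => (F.graph, F.roots))
      (fun _ _ h => RootedForest.ext (congrArg Prod.fst h) (congrArg Prod.snd h))
  Fintype.ofFinite _

/-- `F.Arc u v`: the oriented edge `(u, v)` belongs to `F`, every component being oriented toward
its root. That is, `u` and `v` are adjacent and the edge from `u` to `v` is the first step of the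
path of `F` going from `u` to the root. Then `u` is a child of `v`. -/
def Arc {V : Type*} (F : RootedForest V) (u v : V) : Prop :=
  ∃ (r : V) (h : F.graph.Adj u v) (p : F.graph.Walk v r),
    r ∈ F.roots ∧ (SimpleGraph.Walk.cons h p).IsPath

end RootedForest

/-- The vertex set `{(t, i) | t ∈ [d], i ∈ [n_t]}`. -/
abbrev MultitypeVertex {d : ℕ} (n : Fin d → ℕ) : Type := Σ t : Fin d, Fin (n t)

/-- The rooted multitype forests of profile `n`. -/
abbrev MultitypeForest {d : ℕ} (n : Fin d → ℕ) : Type := RootedForest (MultitypeVertex n)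

namespace MultitypeForest

open Classical in
/-- The number of root vertices of type `s`. -/
noncomputable def rootCount {d : ℕ} {n : Fin d → ℕ} (F : MultitypeForest n) (s : Fin d) : ℕ :=
  (F.roots.filter (fun r => r.1 = s)).card

open Classical in
/-- The number of children of type `s` of the vertex `v`. -/
noncomputable def childCount {d : ℕ} {n : Fin d → ℕ} (F : MultitypeForest n) (s : Fin d)
    (v : MultitypeVertex n) : ℕ :=
  (Finset.univ.filter (fun u : MultitypeVertex n => u.1 = s ∧ RootedForest.Arc F u v)).card

end MultitypeForest

/-- The indeterminates: `z s` for a type `s`, and `x s t i` for types `s`, `t` and a label `i` of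
a vertex of type `t`. -/
inductive ForestVar {d : ℕ} (n : Fin d → ℕ) : Type
  | z (s : Fin d) : ForestVar n
  | x (s t : Fin d) (i : Fin (n t)) : ForestVar n

/-- The indeterminate `z_s`. -/
noncomputable def zVar {d : ℕ} (n : Fin d → ℕ) (s : Fin d) : MvPolynomial (ForestVar n) ℤ :=
  MvPolynomial.X (ForestVar.z s)

/-- The indeterminate `x_{s,t,i}`. -/
noncomputable def xVar {d : ℕ} (n : Fin d → ℕ) (s t : Fin d) (i : Fin (n t)) :
    MvPolynomial (ForestVar n) ℤ :=
  MvPolynomial.X (ForestVar.x s t i)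

/-- The generating function of rooted multitype forests of profile `n`, counted by the number of
roots of each type and the number of children of each type of each vertex. -/
noncomputable def forestGF {d : ℕ} (n : Fin d → ℕ) : MvPolynomial (ForestVar n) ℤ :=
  ∑ F : MultitypeForest n,
    (∏ s : Fin d, zVar n s ^ MultitypeForest.rootCount F s) *
      ∏ s : Fin d, ∏ t : Fin d, ∏ i : Fin (n t),
        xVar n s t i ^ MultitypeForest.childCount F s ⟨t, i⟩

open Classical in
/-- The sum `Γ` over the rooted forests `B` on `[d]` of the product of the `z_s` over the roots
`s` of `B` and of the `∑ i, x_{s,t,i}` over the oriented edges `(s, t)` of `B`. -/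
noncomputable def forestGamma {d : ℕ} (n : Fin d → ℕ) : MvPolynomial (ForestVar n) ℤ :=
  ∑ B : RootedForest (Fin d),
    (∏ s ∈ B.roots, zVar n s) *
      ∏ e ∈ Finset.univ.filter (fun e : Fin d × Fin d => B.Arc e.1 e.2),
        ∑ i : Fin (n e.2), xVar n e.1 e.2 i

/-! Both sides are determinants. A rooted forest amounts to a parent function `V → Option V` without
infinite ascent. Expanding det(diag(z_u + ∑_v w_uv) - w) multilinearly in its rows gives a sum over
all parent functions, in which the cyclic ones cancel (`det_forest_laplacian`); this yields the
matrix forest theorem `sum_prod_eq_det`. For multitype forests, the matrix w has rows depending only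
on the type of the child. So `det_diagonal_sub_of_sigma`, through det(1 - AB) = det(1 - BA),
collapses the determinant to one indexed by `[d]`, leaving the powers n_s - 1. The smaller
determinant is `forestGamma`, by the matrix forest theorem on `[d]`. -/

section ParentFunctions

/-! ### Determinants of parent functions -/

variable {V : Type*}

/-- `ParentStep f v u` means that `v` is the parent of `u` under the parent function `f`. -/
def ParentStep (f : V → Option V) (v u : V) : Prop := f u = some v

/-- The matrix with rows `e_u - e_{f u}`, where `e_{f u} = 0` if `u` has no parent. -/
def parentMatrix [DecidableEq V] (R : Type*) [CommRing R] (f : V → Option V) : Matrix V V R :=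
  fun u => (f u).elim (Pi.single u 1) fun v => Pi.single u 1 - Pi.single v 1

theorem parentMatrix_none [DecidableEq V] (R : Type*) [CommRing R] {f : V → Option V} {u : V}
    (h : f u = none) : parentMatrix R f u = Pi.single u 1 := by
  simp [parentMatrix, h]

theorem parentMatrix_some [DecidableEq V] (R : Type*) [CommRing R] {f : V → Option V} {u v : V}
    (h : f u = some v) : parentMatrix R f u = Pi.single u 1 - Pi.single v 1 := by
  simp [parentMatrix, h]

/-- A parent has smaller rank than its child, so ordering by rank makes the matrix triangular with
identity diagonal blocks. -/
theorem det_parentMatrix_of_wellFounded [DecidableEq V] [Fintype V] (R : Type*) [CommRing R]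
    {f : V → Option V} (hf : WellFounded (ParentStep f)) : (parentMatrix R f).det = 1 := by
  classical
  have : IsWellFounded V (ParentStep f) := ⟨hf⟩
  have key : ∀ u v, u ≠ v → ¬ ParentStep f v u → parentMatrix R f u v = 0 := by
    intro u v huv h
    cases hu : f u with
    | none => simp [parentMatrix_none R hu, huv.symm]
    | some w =>
      have : v ≠ w := by rintro rfl; exact h hu
      simp [parentMatrix_some R hu, huv.symm, this]
  have diag : ∀ u, parentMatrix R f u u = 1 := by
    intro u
    cases hu : f u with
    | none => simp [parentMatrix_none R hu]
    | some w =>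
      have : u ≠ w := by rintro rfl; exact hf.asymmetric u u hu hu
      simp [parentMatrix_some R hu, this]
  have hT : (parentMatrix R f).BlockTriangular fun u => OrderDual.toDual (IsWellFounded.rank (ParentStep f) u) := by
    intro u v huv
    have huv' : IsWellFounded.rank (ParentStep f) u < IsWellFounded.rank (ParentStep f) v := huv
    refine key u v (by rintro rfl; exact lt_irrefl _ huv') fun h => ?_
    exact lt_asymm huv' (IsWellFounded.rank_lt_of_rel h)
  rw [hT.det]
  refine Finset.prod_eq_one fun a _ => ?_
  convert Matrix.det_one (n := { u // OrderDual.toDual (IsWellFounded.rank (ParentStep f) u) = a }) (R := R)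
  ext ⟨u, hu⟩ ⟨v, hv⟩
  by_cases huv : u = v
  · subst huv; simp [Matrix.toSquareBlock_def, diag]
  · rw [Matrix.one_apply_ne (by simpa using huv)]
    refine key u v huv fun h => ?_
    have h1 := IsWellFounded.rank_lt_of_rel h
    rw [OrderDual.toDual.injective (hu.trans hv.symm)] at h1
    exact lt_irrefl _ h1

/-- The indicator of the non-accessible vertices is a nonzero kernel vector: roots are accessible,
and any other vertex is accessible exactly when its parent is. -/
theorem det_parentMatrix_of_not_wellFounded [DecidableEq V] [Fintype V] (R : Type*) [CommRing R]
    [IsDomain R] {f : V → Option V} (hf : ¬ WellFounded (ParentStep f)) :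
    (parentMatrix R f).det = 0 := by
  classical
  have hex : ∃ u, ¬ Acc (ParentStep f) u := by
    by_contra! h
    exact hf ⟨h⟩
  obtain ⟨u₀, hu₀⟩ := hex
  refine Matrix.exists_mulVec_eq_zero_iff.mp
    ⟨fun u => if Acc (ParentStep f) u then 0 else 1, fun h => ?_, ?_⟩
  · simpa [hu₀] using congrFun h u₀
  · ext u
    rw [Matrix.mulVec]
    cases hu : f u with
    | none =>
      have : Acc (ParentStep f) u := ⟨_, fun v hv => by simp [ParentStep, hu] at hv⟩
      simp [parentMatrix_none R hu, this]
    | some w =>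
      have : Acc (ParentStep f) u ↔ Acc (ParentStep f) w := by
        refine ⟨fun h => h.inv hu, fun h => ⟨_, fun v hv => ?_⟩⟩
        have : w = v := by simpa [ParentStep, hu] using hv
        exact this ▸ h
      rw [parentMatrix_some R hu, sub_dotProduct, single_one_dotProduct, single_one_dotProduct]
      simp [this]

open Classical in
/-- The determinant form of the matrix forest theorem, for parent functions. -/
theorem det_forest_laplacian [DecidableEq V] [Fintype V] {R : Type*} [CommRing R] [IsDomain R]
    (z : V → R) (w : V → V → R) :
    (Matrix.diagonal (fun u => z u + ∑ v, w u v) - Matrix.of w).det =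
      ∑ f : V → Option V with WellFounded (ParentStep f), ∏ u, (f u).elim (z u) (w u) := by
  -- Each row is a weighted sum over the possible parents of `u`. The loop term `w u u` has zero
  -- row, matching its cancellation on the diagonal.
  have hrow : (Matrix.diagonal (fun u => z u + ∑ v, w u v) - Matrix.of w) =
      fun u => ∑ o : Option V, o.elim (z u) (w u) •
        o.elim (Pi.single u 1 : V → R) fun v => Pi.single u 1 - Pi.single v 1 := by
    funext u
    rw [Fintype.sum_option]
    funext v
    simp only [Matrix.sub_apply, Matrix.diagonal_apply, Matrix.of_apply, Option.elim, Pi.add_apply,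
      Finset.sum_apply, Pi.smul_apply, Pi.sub_apply, Pi.single_apply, smul_eq_mul, mul_sub,
      Finset.sum_sub_distrib]
    by_cases h : u = v
    · subst h; simp; ring
    · simp [h, Ne.symm h]
  rw [hrow]
  change (Matrix.detRowAlternating (n := V) (R := R)).toMultilinearMap _ = _
  rw [MultilinearMap.map_sum, Finset.sum_filter]
  refine Finset.sum_congr rfl fun f _ => ?_
  rw [MultilinearMap.map_smul_univ]
  change _ • (parentMatrix R f).det = _
  split_ifs with hf
  · rw [det_parentMatrix_of_wellFounded R hf, smul_eq_mul, mul_one]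
  · rw [det_parentMatrix_of_not_wellFounded R hf, smul_zero]

end ParentFunctions

/-! ### From rooted forests to parent functions -/

namespace RootedForest

variable {V : Type*}

theorem eq_root_of_reachable (F : RootedForest V) {r r' : V} (hr : r ∈ F.roots)
    (hr' : r' ∈ F.roots) (h : F.graph.Reachable r r') : r = r' :=
  (F.existsUnique_root (F.graph.connectedComponentMk r')).unique
    ⟨hr, SimpleGraph.ConnectedComponent.sound h⟩ ⟨hr', rfl⟩

theorem exists_path_to_root (F : RootedForest V) (u : V) :
    ∃ r ∈ F.roots, ∃ p : F.graph.Walk u r, p.IsPath := by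
  obtain ⟨r, ⟨hr, hc⟩, -⟩ := F.existsUnique_root (F.graph.connectedComponentMk u)
  obtain ⟨p, hp⟩ := (SimpleGraph.ConnectedComponent.exact hc).symm.exists_isPath
  exact ⟨r, hr, p, hp⟩

theorem Arc.adj {F : RootedForest V} {u v : V} (h : F.Arc u v) : F.graph.Adj u v :=
  h.choose_spec.choose

theorem Arc.right_unique {F : RootedForest V} {u v v' : V} (h : F.Arc u v) (h' : F.Arc u v') :
    v = v' := by
  obtain ⟨r, ha, p, hr, hp⟩ := h
  obtain ⟨r', ha', p', hr', hp'⟩ := h'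
  obtain rfl : r = r' := F.eq_root_of_reachable hr hr'
    ((SimpleGraph.Walk.cons ha p).reachable.symm.trans (SimpleGraph.Walk.cons ha' p').reachable)
  have := congrArg Subtype.val ((F.isAcyclic.subsingleton_path u r).elim ⟨_, hp⟩ ⟨_, hp'⟩)
  injection this

theorem not_arc_of_mem_roots {F : RootedForest V} {u v : V} (hu : u ∈ F.roots) : ¬ F.Arc u v := by
  rintro ⟨r, ha, p, hr, hp⟩
  obtain rfl : u = r := F.eq_root_of_reachable hu hr (SimpleGraph.Walk.cons ha p).reachable
  rw [SimpleGraph.Walk.cons_isPath_iff] at hp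
  exact hp.2 p.end_mem_support

theorem exists_arc_of_notMem_roots {F : RootedForest V} {u : V} (hu : u ∉ F.roots) :
    ∃ v, F.Arc u v := by
  obtain ⟨r, hr, p, hp⟩ := F.exists_path_to_root u
  cases p with
  | nil => exact absurd hr hu
  | cons h p => exact ⟨_, r, h, p, hr, hp⟩

/-- Take the path from `v` to its root. If it avoids `u`, prepend the edge; otherwise its tail from
`u` avoids `v`, by acyclicity. -/
theorem arc_or_arc_of_adj {F : RootedForest V} {u v : V} (h : F.graph.Adj u v) :
    F.Arc u v ∨ F.Arc v u := by
  classical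
  obtain ⟨r, hr, p, hp⟩ := F.exists_path_to_root v
  by_cases hu : u ∈ p.support
  · right
    refine ⟨r, h.symm, p.dropUntil u hu, hr, ?_⟩
    rw [SimpleGraph.Walk.cons_isPath_iff]
    refine ⟨hp.dropUntil hu, ?_⟩
    simpa using F.isAcyclic.ne_mem_support_of_support_of_adj_of_isPath hp.reverse
      (hp.dropUntil hu).reverse h.symm (by simpa using hu)
  · exact Or.inl ⟨r, h, p, hr, by rw [SimpleGraph.Walk.cons_isPath_iff]; exact ⟨hp, hu⟩⟩

theorem adj_iff_arc_or_arc {F : RootedForest V} {u v : V} :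
    F.graph.Adj u v ↔ F.Arc u v ∨ F.Arc v u :=
  ⟨arc_or_arc_of_adj, fun h => h.elim Arc.adj fun h => h.adj.symm⟩

open Classical in
/-- The parent of a vertex, if it is not a root. -/
noncomputable def parent (F : RootedForest V) (u : V) : Option V :=
  if h : ∃ v, F.Arc u v then some h.choose else none

theorem parent_eq_some_iff {F : RootedForest V} {u v : V} : F.parent u = some v ↔ F.Arc u v := by
  unfold parent
  split_ifs with h
  · rw [Option.some_inj]
    exact ⟨fun e => e ▸ h.choose_spec, fun h' => h.choose_spec.right_unique h'⟩
  · exact ⟨fun e => by simp at e, fun h' => absurd ⟨v, h'⟩ h⟩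

theorem parent_eq_none_iff {F : RootedForest V} {u : V} : F.parent u = none ↔ u ∈ F.roots := by
  refine ⟨fun h => ?_, fun h => ?_⟩
  · by_contra hu
    obtain ⟨v, hv⟩ := exists_arc_of_notMem_roots hu
    rw [← parent_eq_some_iff, h] at hv
    simp at hv
  · cases hp : F.parent u with
    | none => rfl
    | some v => exact absurd (parent_eq_some_iff.mp hp) (not_arc_of_mem_roots h)

theorem wellFounded_parentStep (F : RootedForest V) : WellFounded (ParentStep F.parent) := by
  have key : ∀ (u r : V) (p : F.graph.Walk u r), r ∈ F.roots → p.IsPath →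
      Acc (ParentStep F.parent) u := by
    intro u r p hr
    induction p with
    | nil =>
      exact fun _ => ⟨_, fun v hv => absurd (parent_eq_some_iff.mp hv) (not_arc_of_mem_roots hr)⟩
    | cons h p ih =>
      intro hp
      refine ⟨_, fun v' hv' => ?_⟩
      rw [← Arc.right_unique ⟨_, h, p, hr, hp⟩ (parent_eq_some_iff.mp hv')]
      exact ih hr hp.of_cons
  refine ⟨fun u => ?_⟩
  obtain ⟨r, hr, p, hp⟩ := F.exists_path_to_root u
  exact key u r p hr hp

theorem parent_injective : Function.Injective (parent : RootedForest V → V → Option V) := by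
  intro F G h
  have harc : ∀ u v, F.Arc u v ↔ G.Arc u v := fun u v => by
    rw [← parent_eq_some_iff, ← parent_eq_some_iff, h]
  refine RootedForest.ext ?_ ?_
  · ext u v
    rw [adj_iff_arc_or_arc, adj_iff_arc_or_arc, harc, harc]
  · ext u
    rw [← parent_eq_none_iff, ← parent_eq_none_iff, h]

/-! ### From parent functions to rooted forests -/

section OfParent

variable {f : V → Option V}

/-- The graph joining each vertex to its parent. -/
def parentGraph (hf : WellFounded (ParentStep f)) : SimpleGraph V where
  Adj u v := f u = some v ∨ f v = some u
  symm := ⟨fun _ _ h => h.symm⟩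
  loopless := ⟨fun u h => hf.asymmetric u u (h.elim id id) (h.elim id id)⟩

/-- A walk from `r` stays among the descendants of `r`: a step down lengthens the chain of descent,
and a step up from a vertex other than `r` undoes its last link. -/
theorem reflTransGen_of_reachable {G : SimpleGraph V} {r u : V}
    (hG : ∀ x y, G.Adj x y → f y = some x ∨ (f x = some y ∧ x ≠ r)) (h : G.Reachable r u) :
    Relation.ReflTransGen (ParentStep f) r u := by
  rw [SimpleGraph.reachable_iff_reflTransGen] at h
  induction h with
  | refl => exact .refl
  | @tail x y _ hxy ih =>
    rcases hG x y hxy with hy | ⟨hx, hxr⟩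
    · exact ih.tail hy
    · rcases Relation.ReflTransGen.cases_tail ih with e | ⟨y', h', h''⟩
      · exact absurd e hxr
      · have : y = y' := Option.some_inj.mp (hx.symm.trans h'')
        exact this ▸ h'

theorem not_reflTransGen_parent (hf : WellFounded (ParentStep f)) {u v : V} (h : f u = some v) :
    ¬ Relation.ReflTransGen (ParentStep f) u v := by
  intro h'
  have : Relation.TransGen (ParentStep f) u u := Relation.TransGen.tail' h' h
  exact hf.transGen.asymmetric u u this this

/-- Every edge is a bridge: once the edge from `u` to its parent is deleted, only descendants of `u`
are reachable from `u`, and the parent is not one. -/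
theorem parentGraph_isAcyclic (hf : WellFounded (ParentStep f)) :
    (parentGraph hf).IsAcyclic := by
  have key : ∀ u v, f u = some v →
      ¬ (parentGraph hf \ SimpleGraph.fromEdgeSet {s(u, v)}).Reachable u v := by
    intro u v h hr
    refine not_reflTransGen_parent hf h (reflTransGen_of_reachable (fun x y hxy => ?_) hr)
    rw [SimpleGraph.sdiff_adj] at hxy
    rcases hxy.1 with hx | hy
    · refine Or.inr ⟨hx, ?_⟩
      rintro rfl
      obtain rfl : y = v := Option.some_inj.mp (hx.symm.trans h)
      exact hxy.2 (by simp [hxy.1.ne])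
    · exact Or.inl hy
  rw [SimpleGraph.isAcyclic_iff_forall_adj_isBridge]
  intro u v h
  rcases h with h | h
  · exact SimpleGraph.isBridge_iff.mpr (key u v h)
  · rw [Sym2.eq_swap]
    exact SimpleGraph.isBridge_iff.mpr (key v u h)

/-- The support clause, that the path meets only ancestors, keeps the path simple when a child is
prepended. -/
theorem exists_parentGraph_path_to_root (hf : WellFounded (ParentStep f)) (u : V) :
    ∃ r, f r = none ∧ ∃ p : (parentGraph hf).Walk u r, p.IsPath ∧
      ∀ x ∈ p.support, Relation.ReflTransGen (ParentStep f) x u := by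
  induction u using hf.induction with
  | _ u ih =>
    cases hu : f u with
    | none => exact ⟨u, hu, .nil, by simp, by simp [Relation.ReflTransGen.refl]⟩
    | some v =>
      obtain ⟨r, hr, p, hp, hs⟩ := ih v hu
      refine ⟨r, hr, .cons (Or.inl hu) p, ?_, ?_⟩
      · exact (SimpleGraph.Walk.cons_isPath_iff _ _).mpr
          ⟨hp, fun h => not_reflTransGen_parent hf hu (hs u h)⟩
      · intro x hx
        rcases List.mem_cons.mp hx with rfl | hx
        · exact .refl
        · exact (hs x hx).tail hu

open Classical in
/-- The rooted forest with a given well-founded parent function. -/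
noncomputable def ofParent [Fintype V] (hf : WellFounded (ParentStep f)) : RootedForest V where
  graph := parentGraph hf
  isAcyclic := parentGraph_isAcyclic hf
  roots := Finset.univ.filter fun u => f u = none
  existsUnique_root := by
    refine SimpleGraph.ConnectedComponent.ind fun u => ?_
    obtain ⟨r, hr, p, -, -⟩ := exists_parentGraph_path_to_root hf u
    refine ⟨r, ⟨by simpa using hr, SimpleGraph.ConnectedComponent.sound p.reachable.symm⟩, ?_⟩
    rintro r' ⟨hr', hc⟩
    have hreach : (parentGraph hf).Reachable r r' :=
      p.reachable.symm.trans (SimpleGraph.ConnectedComponent.exact hc).symm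
    -- A second root `r'` in the component would descend from `r`, yet it has no parent.
    have h := reflTransGen_of_reachable (f := f) (fun x y hxy => by
      rcases hxy with hx | hy
      · exact Or.inr ⟨hx, by rintro rfl; simp [hr] at hx⟩
      · exact Or.inl hy) hreach
    rcases Relation.ReflTransGen.cases_tail h with e | ⟨y, -, hy⟩
    · exact e
    · have hr'' : f r' = none := by simpa using hr'
      simp [ParentStep, hr''] at hy

theorem parent_ofParent [Fintype V] (hf : WellFounded (ParentStep f)) :
    (ofParent hf).parent = f := by
  classical
  funext u
  cases hu : f u with
  | none => exact parent_eq_none_iff.mpr (by simpa [ofParent] using hu)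
  | some v =>
    obtain ⟨r, hr, p, hp, hs⟩ := exists_parentGraph_path_to_root hf v
    refine parent_eq_some_iff.mpr ⟨r, Or.inl hu, p, by simpa [ofParent] using hr, ?_⟩
    exact (SimpleGraph.Walk.cons_isPath_iff _ _).mpr
      ⟨hp, fun h => not_reflTransGen_parent hf hu (hs u h)⟩

end OfParent

/-! ### The matrix forest theorem -/

open Classical in
theorem prod_parent_elim [Fintype V] {R : Type*} [CommMonoid R] (F : RootedForest V)
    (z : V → R) (w : V → V → R) :
    ∏ u, (F.parent u).elim (z u) (w u) =
      (∏ r ∈ F.roots, z r) * ∏ u, ∏ v, if F.Arc u v then w u v else 1 := by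
  have hroots : ∏ r ∈ F.roots, z r = ∏ u, if u ∈ F.roots then z u else 1 := by
    rw [Finset.prod_ite_mem, Finset.univ_inter]
  rw [hroots, ← Finset.prod_mul_distrib]
  refine Finset.prod_congr rfl fun u _ => ?_
  cases hu : F.parent u with
  | none =>
    have h := parent_eq_none_iff.mp hu
    simp [h, not_arc_of_mem_roots h]
  | some v =>
    have h1 : u ∉ F.roots := by rw [← parent_eq_none_iff, hu]; simp
    have h2 : ∀ v', F.Arc u v' ↔ v = v' := fun v' => by
      rw [← parent_eq_some_iff, hu, Option.some_inj]
    simp [h1, h2]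

open Classical in
/-- The matrix forest theorem. -/
theorem sum_prod_eq_det [Fintype V] [DecidableEq V] {R : Type*} [CommRing R] [IsDomain R]
    (z : V → R) (w : V → V → R) :
    ∑ F : RootedForest V, (∏ r ∈ F.roots, z r) * (∏ u, ∏ v, if F.Arc u v then w u v else 1) =
      (Matrix.diagonal (fun u => z u + ∑ v, w u v) - Matrix.of w).det := by
  rw [det_forest_laplacian]
  refine Finset.sum_bij (fun F _ => F.parent) (fun F _ => ?_) (fun F _ G _ h => parent_injective h)
    (fun f hf => ?_) (fun F _ => (F.prod_parent_elim z w).symm)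
  · simpa using F.wellFounded_parentStep
  · exact ⟨ofParent (Finset.mem_filter.mp hf).2, Finset.mem_univ _, parent_ofParent _⟩

end RootedForest

/-! ### Reduction to a determinant over the types -/

/-- The determinant of a matrix over a fibred index set, whose off-diagonal part has rows that
depend only on the base point, reduces to a determinant over the base. -/
theorem det_diagonal_sub_of_sigma {ι : Type*} [Fintype ι] [DecidableEq ι] {κ : ι → Type*}
    [∀ s, Fintype (κ s)] [∀ s, DecidableEq (κ s)] [∀ s, Nonempty (κ s)] {R : Type*} [CommRing R]
    [IsDomain R] (D : ι → R) (hD : ∀ s, D s ≠ 0) (x : ι → (Σ t, κ t) → R) :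
    (Matrix.diagonal (fun u : Σ t, κ t => D u.1) - Matrix.of fun (u v : Σ t, κ t) => x u.1 v).det =
      (∏ s, D s ^ (Fintype.card (κ s) - 1)) *
        (Matrix.diagonal D - Matrix.of fun s t => ∑ i, x s ⟨t, i⟩).det := by
  -- Passing to the fraction field makes each `D s` invertible.
  let K := FractionRing R
  let φ := algebraMap R K
  have hφ : Function.Injective φ := IsFractionRing.injective R K
  have hK : ∀ s, φ (D s) ≠ 0 := fun s h => hD s (hφ (h.trans (map_zero φ).symm))
  let A : Matrix (Σ t, κ t) ι K := fun u s => if u.1 = s then (φ (D s))⁻¹ else 0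
  let B : Matrix ι (Σ t, κ t) K := fun s v => φ (x s v)
  have h1 : φ.mapMatrix (Matrix.diagonal (fun u : Σ t, κ t => D u.1) -
      Matrix.of fun (u v : Σ t, κ t) => x u.1 v) = Matrix.diagonal (fun u => φ (D u.1)) * (1 - A * B) := by
    ext u v
    have := hK u.1
    have hAB : (A * B) u v = (φ (D u.1))⁻¹ * φ (x u.1 v) := by
      rw [Matrix.mul_apply]
      simp [A, B]
    rw [Matrix.diagonal_mul, Matrix.sub_apply, hAB, mul_sub, mul_inv_cancel_left₀ this]
    simp [Matrix.diagonal_apply, Matrix.one_apply, apply_ite φ]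
  have h2 : φ.mapMatrix (Matrix.diagonal D - Matrix.of fun s t => ∑ i, x s ⟨t, i⟩) =
      (1 - B * A) * Matrix.diagonal (fun s => φ (D s)) := by
    ext s t
    have := hK t
    have hBA : (B * A) s t = ∑ i, φ (x s ⟨t, i⟩) * (φ (D t))⁻¹ := by
      rw [Matrix.mul_apply, Fintype.sum_sigma, Finset.sum_eq_single t]
      · simp [A, B]
      · intro t' _ h; simp [A, h]
      · simp
    rw [Matrix.mul_diagonal, Matrix.sub_apply, hBA, sub_mul, ← Finset.sum_mul,
      inv_mul_cancel_right₀ this]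
    by_cases hst : s = t
    · subst hst; simp
    · simp [hst]
  apply hφ
  rw [map_mul, φ.map_det, φ.map_det, h1, h2, Matrix.det_mul, Matrix.det_mul, Matrix.det_diagonal,
    Matrix.det_diagonal, Matrix.det_one_sub_mul_comm, Fintype.prod_sigma, map_prod]
  -- One factor `D s` per fibre goes to the small determinant; nonempty fibres make the truncated
  -- subtraction exact.
  have h3 : ∀ s, ∏ _i : κ s, φ (D s) = φ (D s ^ (Fintype.card (κ s) - 1)) * φ (D s) := by
    intro s
    rw [Finset.prod_const, Finset.card_univ, ← map_mul, ← pow_succ, ← map_pow,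
      Nat.sub_add_cancel Fintype.card_pos]
  simp only [h3, Finset.prod_mul_distrib]
  ring

/-! ### Monomials of multitype forests and conclusion -/

namespace MultitypeForest

variable {d : ℕ} {n : Fin d → ℕ}

theorem prod_zVar_pow_rootCount (F : MultitypeForest n) :
    ∏ s, zVar n s ^ F.rootCount s = ∏ r ∈ F.roots, zVar n r.1 := by
  classical
  rw [← Finset.prod_fiberwise F.roots (fun r => r.1) fun r => zVar n r.1]
  refine Finset.prod_congr rfl fun s _ => ?_
  rw [Finset.prod_congr rfl fun r hr => by rw [(Finset.mem_filter.mp hr).2], Finset.prod_const]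
  unfold rootCount
  congr!

open Classical in
theorem prod_xVar_pow_childCount (F : MultitypeForest n) :
    ∏ s, ∏ t, ∏ i, xVar n s t i ^ F.childCount s ⟨t, i⟩ =
      ∏ u, ∏ v, if RootedForest.Arc F u v then xVar n u.1 v.1 v.2 else 1 := by
  have h : ∀ s, ∏ t, ∏ i, xVar n s t i ^ F.childCount s ⟨t, i⟩ =
      ∏ v : MultitypeVertex n, ∏ u,
        if u.1 = s ∧ RootedForest.Arc F u v then xVar n s v.1 v.2 else 1 := by
    intro s
    rw [Fintype.prod_sigma]
    refine Finset.prod_congr rfl fun t _ => Finset.prod_congr rfl fun i _ => ?_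
    rw [← Finset.prod_filter, Finset.prod_const]
    rfl
  simp only [h]
  refine Finset.prod_comm.trans (Eq.trans ?_ Finset.prod_comm)
  refine Finset.prod_congr rfl fun v _ => Finset.prod_comm.trans ?_
  refine Finset.prod_congr rfl fun u _ => ?_
  -- Each arc is counted only at the type of its child.
  rw [Finset.prod_eq_single u.1]
  · simp
  · intro s _ hs; simp [hs.symm]
  · simp

end MultitypeForest

/-- Setting every z to 1 and every x to 0 gives 1. -/
theorem zVar_add_sum_ne_zero {d : ℕ} (n : Fin d → ℕ) (s : Fin d) :
    zVar n s + ∑ t : Fin d, ∑ i : Fin (n t), xVar n s t i ≠ 0 := by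
  classical
  intro h
  have := congrArg (MvPolynomial.eval fun v => match v with
    | ForestVar.z _ => (1 : ℤ)
    | ForestVar.x _ _ _ => 0) h
  simp [zVar, xVar] at this

theorem mainTheorem4 {d : ℕ} (n : Fin d → ℕ) (hn : ∀ t, 0 < n t) :
    forestGF n =
      (∏ s : Fin d, (zVar n s + ∑ t : Fin d, ∑ i : Fin (n t), xVar n s t i) ^ (n s - 1)) *
        forestGamma n := by
  classical
  have : ∀ t, Nonempty (Fin (n t)) := fun t => ⟨⟨0, hn t⟩⟩
  have hGF := RootedForest.sum_prod_eq_det (V := MultitypeVertex n) (fun u => zVar n u.1)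
    fun u v => xVar n u.1 v.1 v.2
  have hΓ := RootedForest.sum_prod_eq_det (V := Fin d) (zVar n) fun s t => ∑ i, xVar n s t i
  have hdet := det_diagonal_sub_of_sigma (κ := fun t => Fin (n t))
    (fun s => zVar n s + ∑ t, ∑ i, xVar n s t i) (zVar_add_sum_ne_zero n)
    fun s v => xVar n s v.1 v.2
  have e1 : forestGF n = ∑ F : RootedForest (MultitypeVertex n), (∏ r ∈ F.roots, zVar n r.1) *
      ∏ u, ∏ v, if F.Arc u v then xVar n u.1 v.1 v.2 else 1 := by
    refine Finset.sum_congr rfl fun F _ => ?_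
    rw [MultitypeForest.prod_zVar_pow_rootCount, MultitypeForest.prod_xVar_pow_childCount]
  have e2 : forestGamma n = ∑ B : RootedForest (Fin d), (∏ r ∈ B.roots, zVar n r) *
      ∏ s, ∏ t, if B.Arc s t then ∑ i, xVar n s t i else 1 := by
    refine Finset.sum_congr rfl fun B _ => ?_
    rw [Finset.prod_filter, Fintype.prod_prod_type]
  simp only [Fintype.sum_sigma] at hGF
  simp only [Fintype.card_fin] at hdet
  rw [e1, e2, hΓ, hGF]
  exact hdet
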